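/- An orientation of the $n$-dimensional hypercube is given by a map $o:\{0,1\}^n\to\{0,1\}^n$ with $o(v)_i\neq o(v\oplus e_i)_i$ for all $v,i$, where $o(v)_i=1$ means that the edge $\{v,v\oplus e_i\}$ is directed away from $v$. It is a unique sink orientation (USO) if every non-empty face contains exactly one vertex without outgoing edges inside that face. A Matoušek-type USO is an orientation of the form $o(v)=M(v\oplus s)$ for all $v\in\{0,1\}^n$, with $M=PAP^T$ over $GF(2)$, where $P$ is a permutation matrix, $A\in GF(2)^{n\times n}$ is invertible and upper-triangular, and $s\in\{0,1\}^n$. For a real P-matrix $M\in\mathbb{R}^{n\times n}$ (all principal minors are positive), a vector $q\in\mathbb{R}^n$ and a vertex $v$, let $A_v$ be the matrix whose $j$-th column is the $j$-th column of $-M$ if $v_j=1$ and the $j$-th unit vector if $v_j=0$. The P-matrix linear complementarity instance $(M,q)$ is non-degenerate if $(A_v^{-1}q)_i\neq 0$ for all $v$ and $i$; it then produces the orientation with $o(v)_i=1$ if and only if $(A_v^{-1}q)_i<0$. A USO is realizable if it is produced in this way by some non-degenerate instance $(M,q)$ with $M$ a P-matrix. **Lemma.** For every $n\ge 0$, the number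 of realizable $n$-dimensional Matoušek-type USOs is exactly $2^n\,(n+1)^{n-1}$. In particular, this number is $2^{\Theta(n\log n)}$ as $n\to\infty$. -/

import Mathlib

open Matrix Filter Asymptotics

namespace MatousekUSO

/-- Vertices of the `n`-dimensional hypercube: vectors over `GF(2)`. -/
abbrev Cube (n : ℕ) : Type := Fin n → ZMod 2

/-- The outmap `o` describes an orientation of the hypercube. The edge between `v` and `v ⊕ e_i`
is directed away from `v` iff `o v i = 1`; both endpoints have to agree on its direction. -/
def IsOrientation {n : ℕ} (o : Cube n → Cube n) : Prop :=
  ∀ (v : Cube n) (i : Fin n), o v i ≠ o (v + Pi.single i 1) i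

/-- The (non-empty) face of the hypercube through `v` spanned by the dimensions in `S`. -/
def face {n : ℕ} (v : Cube n) (S : Finset (Fin n)) : Set (Cube n) :=
  {u | ∀ i, i ∉ S → u i = v i}

/-- A unique sink orientation: each non-empty face contains exactly one vertex without outgoing
edges inside the face. -/
def IsUSO {n : ℕ} (o : Cube n → Cube n) : Prop :=
  IsOrientation o ∧
    ∀ (v : Cube n) (S : Finset (Fin n)), ∃! u : Cube n, u ∈ face v S ∧ ∀ i ∈ S, o u i = 0

/-- A Matoušek-type USO: an orientation of the form `o v = M (v ⊕ s)` with `M = P A Pᵀ`, where `P`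
is a permutation matrix and `A` is invertible and upper-triangular over `GF(2)`. -/
def IsMatousekType {n : ℕ} (o : Cube n → Cube n) : Prop :=
  IsOrientation o ∧
    ∃ (σ : Equiv.Perm (Fin n)) (A : Matrix (Fin n) (Fin n) (ZMod 2)) (s : Cube n),
      IsUnit A ∧ (∀ i j : Fin n, j < i → A i j = 0) ∧
        ∀ v : Cube n,
          o v = (σ.permMatrix (ZMod 2) * A * (σ.permMatrix (ZMod 2))ᵀ) *ᵥ (v + s)

/-- A real square matrix is a P-matrix if all of its principal minors are positive. -/
def IsPMatrix {n : ℕ} (M : Matrix (Fin n) (Fin n) ℝ) : Prop :=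
  ∀ S : Finset (Fin n),
    0 < (M.submatrix (fun i : {i // i ∈ S} => (i : Fin n)) (fun i : {i // i ∈ S} => (i : Fin n))).det

/-- An instance of the P-matrix linear complementarity problem: given `M` and `q`, find vectors
`w, z ≥ 0` with `w - M z = q` and `wᵀ z = 0`. -/
structure PLCP (n : ℕ) where
  M : Matrix (Fin n) (Fin n) ℝ
  q : Fin n → ℝ
  isPMatrix : IsPMatrix M

namespace PLCP

/-- The complementary basis matrix `A_B` for `B = {j | v j = 1}`: its `j`-th column is the `j`-th
column of `-M` if `j ∈ B`, and the `j`-th column of the identity matrix otherwise. -/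
def basisMatrix {n : ℕ} (I : PLCP n) (v : Cube n) : Matrix (Fin n) (Fin n) ℝ :=
  Matrix.of fun i j => if v j = 1 then -I.M i j else (1 : Matrix (Fin n) (Fin n) ℝ) i j

/-- The complementary basic vector `A_B⁻¹ q`; its `j`-th entry is the value of `z j` if `j ∈ B`, and
of `w j` otherwise. (As `M` is a P-matrix, every `A_B` is invertible.) -/
noncomputable def basicVector {n : ℕ} (I : PLCP n) (v : Cube n) : Fin n → ℝ :=
  (I.basisMatrix v)⁻¹ *ᵥ I.q

/-- The instance is non-degenerate: no complementary basic vector has a zero entry. -/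
def Nondegenerate {n : ℕ} (I : PLCP n) : Prop :=
  ∀ (v : Cube n) (i : Fin n), I.basicVector v i ≠ 0

/-- The Stickney–Watson reduction: the edge between `v` and `v ⊕ e_i` is directed away from `v`
iff `(A_B⁻¹ q) i < 0`. -/
noncomputable def outmap {n : ℕ} (I : PLCP n) : Cube n → Cube n :=
  fun v i => if I.basicVector v i < 0 then 1 else 0

end PLCP

/-- A USO is realizable if it is produced by some non-degenerate P-LCP instance. -/
def IsRealizable {n : ℕ} (o : Cube n → Cube n) : Prop :=
  IsUSO o ∧ ∃ I : PLCP n, I.Nondegenerate ∧ I.outmap = o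

/-- The number of realizable `n`-dimensional Matoušek-type USOs. -/
noncomputable def numRealizable (n : ℕ) : ℕ :=
  Nat.card {o : Cube n → Cube n // IsMatousekType o ∧ IsRealizable o}

end MatousekUSO

/-! The orientation condition forces a unit diagonal on `M`, so `o` is determined by the shift `s`
and a relation: `j` lies below `i` when `M i j = 1`. The claim is that `o` is realizable exactly
when this relation is a forest order, that is, a partial order in which the elements below any
element form a chain.

Necessity is a sign argument: the basic vectors at the four vertices of a 2-face satisfy a
Grassmann–Plücker relation (`plucker_of_solutions`). At the 2-face through the global sink `s`, a
forbidden pattern of entries would give its two sides opposite signs (`entry_eq_of_realizable`).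

Sufficiency is explicit: `realForestMatrix` is triangular with unit diagonal up to a reordering, and
its basic vectors are the sign vectors of the outmap, by a sum telescoping along the chain below
each element (`zsgn_mul_zsgn_mulVec`).

Distinct pairs of shift and forest order give distinct orientations, so it remains to count labelled
rooted forests. Removing the vertices attached directly to roots gives a recursion, solved by
`card_add_mul_numAcyclic`. -/

namespace MatousekUSO

/-! ### Counting acyclic parent maps -/

/-- A map `f` sending each `v` to its parent in `V` or to a root in `R` is acyclic. -/
def IsAcyclicMap {V R : Type} (f : V → V ⊕ R) : Prop :=
  WellFounded fun w v => f v = Sum.inl w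

/-- The map which sends `I` to `R` by `h` and the complement of `I` to `V` by `g`. -/
noncomputable def glue {V R : Type} (I : Finset V) (h : {v // v ∈ I} → R)
    (g : {v // v ∉ I} → {v // v ∉ I} ⊕ {v // v ∈ I}) (v : V) : V ⊕ R :=
  open Classical in
  if hv : v ∈ I then Sum.inr (h ⟨v, hv⟩) else Sum.inl (Sum.elim (↑) (↑) (g ⟨v, hv⟩))

section glue

variable {V R : Type} {I : Finset V} {h : {v // v ∈ I} → R}
  {g : {v // v ∉ I} → {v // v ∉ I} ⊕ {v // v ∈ I}}

theorem glue_of_mem {v : V} (hv : v ∈ I) : glue I h g v = Sum.inr (h ⟨v, hv⟩) := by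
  simp [glue, hv]

theorem glue_of_notMem {v : V} (hv : v ∉ I) :
    glue I h g v = Sum.inl (Sum.elim (↑) (↑) (g ⟨v, hv⟩)) := by
  simp [glue, hv]

theorem elim_val_injective :
    Function.Injective (Sum.elim (↑) (↑) : {v // v ∉ I} ⊕ {v // v ∈ I} → V) := by
  rintro (⟨a, ha⟩ | ⟨a, ha⟩) (⟨b, hb⟩ | ⟨b, hb⟩) hab <;> simp only [Sum.elim_inl, Sum.elim_inr] at hab <;>
    subst hab <;> first | rfl | exact absurd ‹a ∈ I› ‹a ∉ I›

/-- A parent chain that reaches `I` stops there, because vertices of `I` are sent to roots. An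
infinite chain therefore stays in the complement, where it follows `g`. -/
theorem isAcyclicMap_glue_iff : IsAcyclicMap (glue I h g) ↔ IsAcyclicMap g := by
  constructor
  · intro hf
    refine Subrelation.wf ?_ (InvImage.wf (Subtype.val : {v // v ∉ I} → V) hf)
    intro a b hab
    simp [InvImage, glue_of_notMem b.2, hab]
  · intro hg
    have hI : ∀ v ∈ I, Acc (fun w v => glue I h g v = Sum.inl w) v := fun v hv =>
      ⟨_, fun y hy => by simp [glue_of_mem hv] at hy⟩
    have hIc : ∀ v : {v // v ∉ I}, Acc (fun w v => glue I h g v = Sum.inl w) (v : V) := by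
      intro v
      induction v using hg.induction with
      | _ v ih =>
        refine ⟨_, fun y hy => ?_⟩
        rw [glue_of_notMem v.2] at hy
        rcases hgv : g v with w | w
        · simp only [hgv, Subtype.coe_eta, Sum.elim_inl, Sum.inl.injEq] at hy
          exact hy ▸ ih w hgv
        · simp only [hgv, Subtype.coe_eta, Sum.elim_inr, Sum.inl.injEq] at hy
          exact hy ▸ hI w w.2
    refine ⟨fun v => ?_⟩
    by_cases hv : v ∈ I
    · exact hI v hv
    · exact hIc ⟨v, hv⟩

theorem glue_injective : Function.Injective
    (fun x : (I : Finset V) × ({v // v ∈ I} → R) ×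
      {g : {v // v ∉ I} → {v // v ∉ I} ⊕ {v // v ∈ I} // IsAcyclicMap g} =>
      glue x.1 x.2.1 x.2.2.1) := by
  rintro ⟨I, h, g, hg⟩ ⟨I', h', g', hg'⟩ he
  simp only at he
  have hII : I = I' := by
    ext v
    have := congrFun he v
    by_cases h1 : v ∈ I <;> by_cases h2 : v ∈ I' <;>
      simp [glue, h1, h2] at this ⊢
  subst hII
  have h1 : h = h' := by
    ext v
    have := congrFun he v
    rwa [glue_of_mem v.2, glue_of_mem v.2, Sum.inr.injEq] at this
  have h2 : g = g' := by
    funext v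
    have := congrFun he v
    rw [glue_of_notMem v.2, glue_of_notMem v.2, Sum.inl.injEq] at this
    exact elim_val_injective this
  subst h1 h2
  rfl

theorem exists_glue_eq [Fintype V] (f : V → V ⊕ R) :
    ∃ (I : Finset V) (h : {v // v ∈ I} → R)
      (g : {v // v ∉ I} → {v // v ∉ I} ⊕ {v // v ∈ I}), glue I h g = f := by
  classical
  let I : Finset V := {v | (f v).isRight}
  have h1 : ∀ v : {v // v ∈ I}, ∃ r, f v = Sum.inr r := fun v => by
    have := v.2
    simpa [I, Sum.isRight_iff] using this
  have h2 : ∀ v : {v // v ∉ I}, ∃ y : {v // v ∉ I} ⊕ {v // v ∈ I},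
      f v = Sum.inl (Sum.elim (↑) (↑) y) := fun v => by
    have := v.2
    simp only [I, Finset.mem_filter, Finset.mem_univ, true_and, Bool.not_eq_true,
      Sum.isRight_eq_false, Sum.isLeft_iff] at this
    obtain ⟨w, hw⟩ := this
    by_cases hwI : w ∈ I
    · exact ⟨Sum.inr ⟨w, hwI⟩, by simp [hw]⟩
    · exact ⟨Sum.inl ⟨w, hwI⟩, by simp [hw]⟩
  choose h hh using h1
  choose g hg using h2
  refine ⟨I, h, g, funext fun v => ?_⟩
  by_cases hv : v ∈ I
  · rw [glue_of_mem hv, hh ⟨v, hv⟩]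
  · rw [glue_of_notMem hv, hg ⟨v, hv⟩]

end glue

/-- The number of acyclic maps with vertices `V` and roots `R`. -/
noncomputable def numAcyclic (V R : Type) : ℕ := Nat.card {f : V → V ⊕ R // IsAcyclicMap f}

/-- Sort the maps by the set `I` of vertices attached directly to a root; these vertices serve as
the roots for the rest. -/
theorem numAcyclic_eq_sum (V R : Type) [Fintype V] [Fintype R] :
    numAcyclic V R = ∑ I : Finset V,
      Fintype.card R ^ I.card * numAcyclic {v // v ∉ I} {v // v ∈ I} := by
  classical
  let F : ((I : Finset V) × ({v // v ∈ I} → R) ×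
      {g : {v // v ∉ I} → {v // v ∉ I} ⊕ {v // v ∈ I} // IsAcyclicMap g}) →
      {f : V → V ⊕ R // IsAcyclicMap f} :=
    fun x => ⟨glue x.1 x.2.1 x.2.2.1, isAcyclicMap_glue_iff.2 x.2.2.2⟩
  have hF : Function.Bijective F := by
    refine ⟨fun x y hxy => glue_injective (congrArg Subtype.val hxy), ?_⟩
    rintro ⟨f, hf⟩
    obtain ⟨I, h, g, rfl⟩ := exists_glue_eq f
    exact ⟨⟨I, h, g, isAcyclicMap_glue_iff.1 hf⟩, rfl⟩
  rw [numAcyclic, ← Nat.card_eq_of_bijective F hF, Nat.card_sigma]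
  refine Finset.sum_congr rfl fun I _ => ?_
  simp [numAcyclic]

theorem numAcyclic_of_isEmpty (V R : Type) [IsEmpty R] [Nonempty V] : numAcyclic V R = 0 := by
  rw [numAcyclic, Nat.card_eq_zero]
  refine Or.inl ⟨fun ⟨f, hf⟩ => ?_⟩
  obtain ⟨m, -, hm⟩ := hf.has_min Set.univ Set.univ_nonempty
  rcases hfm : f m with w | r
  · exact hm w trivial hfm
  · exact isEmptyElim r

/-- This is the binomial theorem differentiated in `a` and multiplied by `a`. -/
theorem sum_card_mul_pow (V : Type) [Fintype V] (a b : ℕ) :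
    ∑ I : Finset V, I.card * a ^ I.card * b ^ (Fintype.card V - I.card) =
      Fintype.card V * a * (a + b) ^ (Fintype.card V - 1) := by
  classical
  have h := Finset.sum_powerset_apply_card
    (fun i => i * a ^ i * b ^ (Fintype.card V - i)) (x := (Finset.univ : Finset V))
  rw [Finset.powerset_univ, Finset.card_univ] at h
  rw [h]
  rcases Fintype.card V with _ | m
  · simp
  · rw [Finset.sum_range_succ', add_pow]
    simp only [smul_eq_mul, zero_mul, mul_zero, add_zero, Nat.add_sub_cancel, Finset.mul_sum]
    refine Finset.sum_congr rfl fun i _ => ?_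
    have h1 := Nat.add_one_mul_choose_eq m i
    rw [Nat.add_sub_add_right, pow_succ]
    calc _ = ((m + 1).choose (i + 1) * (i + 1)) * (a ^ i * a * b ^ (m - i)) := by ring
      _ = _ := by rw [← h1]; push_cast; ring

/-- The factor `m + |R|` on both sides replaces the exponent `m - 1`, which would need a separate
reading at `m = 0`. The number of roots must vary in the induction. -/
theorem card_add_mul_numAcyclic (m : ℕ) : ∀ (V R : Type) [Fintype V] [Fintype R],
    Fintype.card V = m →
      (m + Fintype.card R) * numAcyclic V R = Fintype.card R * (m + Fintype.card R) ^ m := by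
  induction m using Nat.strong_induction_on with
  | _ m ih =>
    intro V R _ _ hV
    classical
    rcases Nat.eq_zero_or_pos m with rfl | hm
    · have : IsEmpty V := Fintype.card_eq_zero_iff.1 hV
      have h1 : numAcyclic V R = 1 := by
        rw [numAcyclic, Nat.card_eq_one_iff_unique]
        refine ⟨inferInstance, ⟨⟨isEmptyElim, ⟨isEmptyElim⟩⟩⟩⟩
      simp [h1]
    have hne : Nonempty V := Fintype.card_pos_iff.1 (hV ▸ hm)
    -- The factor `m` fits the induction hypothesis: `m - |I|` vertices and `|I|` roots add up to
    -- `m`. The sum becomes that of `sum_card_mul_pow` with `a = |R|`, `b = m`.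
    have key : m * numAcyclic V R = m * (Fintype.card R * (m + Fintype.card R) ^ (m - 1)) := by
      rw [numAcyclic_eq_sum, Finset.mul_sum, ← mul_assoc, add_comm m]
      have h := sum_card_mul_pow V (Fintype.card R) m
      rw [hV] at h
      rw [← h]
      refine Finset.sum_congr rfl fun I _ => ?_
      have hcard : Fintype.card {v // v ∉ I} = m - I.card := by
        rw [Fintype.card_subtype_compl, hV, Fintype.card_coe]
      have hle : I.card ≤ m := hV ▸ Finset.card_le_univ I
      rcases I.eq_empty_or_nonempty with rfl | hI
      · have : Nonempty {v : V // v ∉ (∅ : Finset V)} := hne.map fun v => ⟨v, by simp⟩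
        rw [numAcyclic_of_isEmpty]
        simp
      · have hpos : 0 < I.card := hI.card_pos
        have := ih (m - I.card) (by omega) {v // v ∉ I} {v // v ∈ I} hcard
        rw [Fintype.card_coe, Nat.sub_add_cancel hle] at this
        rw [mul_left_comm, this]
        ring
    rw [Nat.eq_of_mul_eq_mul_left hm key, mul_left_comm, ← pow_succ', Nat.sub_add_cancel hm]

theorem numAcyclic_fin_unit (n : ℕ) : numAcyclic (Fin n) Unit = (n + 1) ^ (n - 1) := by
  have h := card_add_mul_numAcyclic n (Fin n) Unit (Fintype.card_fin n)
  rw [Fintype.card_unit, one_mul] at h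
  refine Nat.eq_of_mul_eq_mul_left (Nat.succ_pos n) (h.trans ?_)
  rcases n with _ | n
  · simp
  · rw [Nat.add_sub_cancel, ← pow_succ']

/-! ### Forest orders -/

/-- A partial order in which the elements below any given element form a chain. -/
structure IsForestOrder {V : Type} (r : V → V → Prop) : Prop where
  refl : ∀ a, r a a
  antisymm : ∀ a b, r a b → r b a → a = b
  trans : ∀ a b c, r a b → r b c → r a c
  chain : ∀ a b c, r a c → r b c → r a b ∨ r b a

namespace IsForestOrder

variable {V : Type} {r : V → V → Prop}

theorem wellFounded_strict [Finite V] (hr : IsForestOrder r) :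
    WellFounded fun a b => r a b ∧ a ≠ b := by
  have h1 : IsTrans V fun a b => r a b ∧ a ≠ b := ⟨fun a b c hab hbc =>
    ⟨hr.trans a b c hab.1 hbc.1, fun h => hab.2 (hr.antisymm a b hab.1 (h ▸ hbc.1))⟩⟩
  have h2 : Std.Irrefl fun a b : V => r a b ∧ a ≠ b := ⟨fun a h => h.2 rfl⟩
  exact Finite.wellFounded_of_trans_of_irrefl _

/-- Every non-minimal element has a unique lower cover. -/
theorem minimal_or_exists_pred [Finite V] (hr : IsForestOrder r) (i : V) :
    (∀ j, r j i → j = i) ∨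
      ∃ p, p ≠ i ∧ r p i ∧ ∀ j, j ≠ i → r j i → r j p := by
  by_cases h : ∀ j, r j i → j = i
  · exact Or.inl h
  · push Not at h
    -- The reversed strict order yields a maximal element strictly below `i`; the chain condition
    -- makes it the greatest.
    have hwf : WellFounded fun a b => r b a ∧ b ≠ a := by
      have h1 : IsTrans V fun a b => r b a ∧ b ≠ a := ⟨fun a b c hab hbc =>
        ⟨hr.trans c b a hbc.1 hab.1, fun h => hab.2 (hr.antisymm b a hab.1 (h ▸ hbc.1))⟩⟩
      have h2 : Std.Irrefl fun a b : V => r b a ∧ b ≠ a := ⟨fun a h => h.2 rfl⟩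
      exact Finite.wellFounded_of_trans_of_irrefl _
    obtain ⟨p, ⟨hp1, hp2⟩, hp⟩ := hwf.has_min {j | r j i ∧ j ≠ i} h
    refine Or.inr ⟨p, hp2, hp1, fun j hj hji => ?_⟩
    rcases hr.chain j p i hji hp1 with h' | h'
    · exact h'
    · by_contra hjp
      exact hp j ⟨hji, hj⟩ ⟨h', fun h => hjp (h ▸ hr.refl _)⟩

end IsForestOrder

/-- The order generated by a parent map: ancestors are smaller. -/
def ancestorRel {V R : Type} (f : V → V ⊕ R) : V → V → Prop :=
  Relation.ReflTransGen fun w v => f v = Sum.inl w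

section ancestorRel

variable {V R : Type} {f : V → V ⊕ R}

theorem ancestorRel_iff {a b : V} :
    ancestorRel f a b ↔ a = b ∨ ∃ p, f b = Sum.inl p ∧ ancestorRel f a p := by
  rw [ancestorRel, Relation.ReflTransGen.cases_tail_iff, eq_comm]
  simp only [and_comm]

theorem ancestorRel_of_eq {p b : V} (h : f b = Sum.inl p) : ancestorRel f p b :=
  Relation.ReflTransGen.single h

theorem IsAcyclicMap.ancestorRel_antisymm (hf : IsAcyclicMap f) {a b : V}
    (hab : ancestorRel f a b) (hba : ancestorRel f b a) : a = b := by
  rcases Relation.reflTransGen_iff_eq_or_transGen.1 hab with h | h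
  · exact h.symm
  · have : Relation.TransGen (fun w v => f v = Sum.inl w) a a :=
      Relation.TransGen.trans_left h hba
    exact (hf.transGen.irrefl.irrefl a this).elim

theorem IsAcyclicMap.isForestOrder (hf : IsAcyclicMap f) : IsForestOrder (ancestorRel f) where
  refl _ := Relation.ReflTransGen.refl
  antisymm _ _ := hf.ancestorRel_antisymm
  trans _ _ _ := Relation.ReflTransGen.trans
  chain a b c hac hbc := by
    induction hac with
    | refl => exact Or.inr hbc
    | tail h1 h2 ih =>
      rcases ancestorRel_iff.1 hbc with rfl | ⟨p, hp, hbp⟩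
      · exact Or.inl (h1.tail h2)
      · rw [h2, Sum.inl.injEq] at hp
        subst hp
        exact ih hbp

/-- The parent is the greatest strict ancestor, hence can be read off from the order alone. -/
theorem IsAcyclicMap.apply_eq_inl_iff (hf : IsAcyclicMap f) {v w : V} :
    f v = Sum.inl w ↔ w ≠ v ∧ ancestorRel f w v ∧
      ∀ u, u ≠ v → ancestorRel f u v → ancestorRel f u w := by
  constructor
  · intro h
    refine ⟨?_, ancestorRel_of_eq h, fun u hu huv => ?_⟩
    · rintro rfl
      exact hf.irrefl.irrefl w h
    · rcases ancestorRel_iff.1 huv with rfl | ⟨p, hp, hup⟩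
      · exact (hu rfl).elim
      · rw [h, Sum.inl.injEq] at hp
        exact hp ▸ hup
  · rintro ⟨hne, hwv, hmax⟩
    rcases ancestorRel_iff.1 hwv with rfl | ⟨p, hp, hwp⟩
    · exact (hne rfl).elim
    · have hpv : p ≠ v := by
        rintro rfl
        exact hf.irrefl.irrefl p hp
      rw [hp, hf.ancestorRel_antisymm hwp (hmax p hpv (ancestorRel_of_eq hp))]

theorem ancestorRel_injective {f g : V → V ⊕ Unit} (hf : IsAcyclicMap f) (hg : IsAcyclicMap g)
    (h : ancestorRel f = ancestorRel g) : f = g := by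
  funext v
  have key : ∀ w, f v = Sum.inl w ↔ g v = Sum.inl w := fun w => by
    rw [hf.apply_eq_inl_iff, hg.apply_eq_inl_iff, h]
  rcases hfv : f v with w | u
  · exact ((key w).1 hfv).symm
  · rcases hgv : g v with w | u'
    · rw [(key w).2 hgv] at hfv
      cases hfv
    · rfl

theorem IsForestOrder.exists_ancestorRel_eq [Finite V] {r : V → V → Prop}
    (hr : IsForestOrder r) : ∃ f : V → V ⊕ Unit, IsAcyclicMap f ∧ ancestorRel f = r := by
  have h : ∀ i, ∃ y : V ⊕ Unit, (y = Sum.inr () ∧ ∀ j, r j i → j = i) ∨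
      ∃ p, y = Sum.inl p ∧ p ≠ i ∧ r p i ∧ ∀ j, j ≠ i → r j i → r j p := fun i => by
    rcases hr.minimal_or_exists_pred i with h | ⟨p, h⟩
    · exact ⟨_, Or.inl ⟨rfl, h⟩⟩
    · exact ⟨_, Or.inr ⟨p, rfl, h⟩⟩
  choose f hf using h
  have hfr : ∀ i p, f i = Sum.inl p → p ≠ i ∧ r p i ∧ ∀ j, j ≠ i → r j i → r j p := by
    intro i p hip
    rcases hf i with ⟨h, -⟩ | ⟨p', h, h'⟩
    · rw [hip] at h
      cases h
    · rw [hip, Sum.inl.injEq] at h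
      exact h ▸ h'
  refine ⟨f, Subrelation.wf (fun {a b} hab => ?_) hr.wellFounded_strict, ?_⟩
  · obtain ⟨h1, h2, -⟩ := hfr b a hab
    exact ⟨h2, h1⟩
  · funext a b
    apply propext
    induction b using hr.wellFounded_strict.induction with
    | _ b ih =>
      rw [ancestorRel_iff]
      constructor
      · rintro (rfl | ⟨p, hp, hap⟩)
        · exact hr.refl a
        · obtain ⟨h1, h2, -⟩ := hfr b p hp
          exact hr.trans a p b ((ih p ⟨h2, h1⟩).1 hap) h2
      · intro hab
        by_cases hne : a = b
        · exact Or.inl hne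
        · rcases hf b with ⟨-, h⟩ | ⟨p, h, h1, h2, h3⟩
          · exact (hne (h a hab)).elim
          · exact Or.inr ⟨p, h, (ih p ⟨h2, h1⟩).2 (h3 a hne hab)⟩

end ancestorRel

theorem card_isForestOrder (n : ℕ) :
    Nat.card {r : Fin n → Fin n → Prop // IsForestOrder r} = (n + 1) ^ (n - 1) := by
  rw [← numAcyclic_fin_unit, numAcyclic]
  let F : {f : Fin n → Fin n ⊕ Unit // IsAcyclicMap f} →
      {r : Fin n → Fin n → Prop // IsForestOrder r} :=
    fun f => ⟨ancestorRel f.1, f.2.isForestOrder⟩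
  refine (Nat.card_eq_of_bijective F ⟨fun f g hfg => ?_, fun r => ?_⟩).symm
  · exact Subtype.ext (ancestorRel_injective f.2 g.2 (congrArg Subtype.val hfg))
  · obtain ⟨f, hf, hfr⟩ := r.2.exists_ancestorRel_eq
    exact ⟨⟨f, hf⟩, Subtype.ext hfr⟩

/-- A finite linear order is isomorphic to an initial segment of the natural numbers. -/
theorem exists_equiv_fin_of_isLinearOrder {V : Type} [Fintype V] {n : ℕ} (hV : Fintype.card V = n)
    (s : V → V → Prop) (hs : IsLinearOrder V s) : ∃ e : V ≃ Fin n, ∀ a b, s a b → e a ≤ e b := by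
  classical
  let _ : LinearOrder V :=
    { le := s
      le_refl := hs.refl
      le_trans := hs.trans
      le_antisymm := hs.antisymm
      le_total := hs.total
      toDecidableLE := Classical.decRel _ }
  let e := Fintype.orderIsoFinOfCardEq V hV
  exact ⟨e.symm.toEquiv, fun a b hab => e.symm.monotone hab⟩

/-- A linear extension of the dual of a forest order, as a permutation. -/
theorem IsForestOrder.exists_perm {n : ℕ} {r : Fin n → Fin n → Prop} (hr : IsForestOrder r) :
    ∃ σ : Equiv.Perm (Fin n), ∀ i j, r j i → σ i ≤ σ j := by
  have : IsPartialOrder (Fin n) (fun i j => r j i) :=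
    { refl := hr.refl
      trans := fun a b c hab hbc => hr.trans c b a hbc hab
      antisymm := fun a b hab hba => hr.antisymm a b hba hab }
  obtain ⟨s, hs, hrs⟩ := extend_partialOrder (fun i j => r j i)
  obtain ⟨σ, hσ⟩ := exists_equiv_fin_of_isLinearOrder (Fintype.card_fin n) s hs
  exact ⟨σ, fun i j hij => hσ i j (hrs i j hij)⟩

/-! ### Realizability forces a forest order -/

theorem det_of_perm_upperTriangular {m R : Type} [Fintype m] [DecidableEq m] [CommRing R]
    {α : Type} [LinearOrder α] (b : m → α) (hb : Function.Injective b) (M : Matrix m m R)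
    (h : ∀ i j, b j < b i → M i j = 0) : M.det = ∏ i, M i i := by
  let _ : LinearOrder m := LinearOrder.lift' b hb
  convert Matrix.det_of_isUpperTriangular (M := M) fun i j hij => h i j hij

/-- Solutions of four systems which differ in the columns `i` and `j` satisfy a quadratic
relation (a three-term Grassmann–Plücker relation in disguise). -/
theorem plucker_of_solutions {n : ℕ} {A : Matrix (Fin n) (Fin n) ℝ} (hA : A.det ≠ 0)
    {q δi δj x x' y y' : Fin n → ℝ} {i j : Fin n} (k : Fin n)
    (hx : A *ᵥ x = q) (hx' : A *ᵥ x' + x' i • δi = q) (hy : A *ᵥ y + y j • δj = q)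
    (hy' : A *ᵥ y' + y' i • δi + y' j • δj = q) (hxj : x j ≠ 0) :
    y j * y' i * (x' j * x k - x j * x' k) = x' i * x j * (y' j * y k - y j * y' k) := by
  -- `A` maps both `x - x'` and `y' j • (y - x) - y j • (y' - x)` to multiples of `δi`. The scalars
  -- equalize the two images, so the difference is in the kernel; coordinates `j` and `k` then give
  -- the relation.
  have h0 : A *ᵥ ((y j * y' i) • (x j • x - x j • x') -
      (x j * x' i) • (y' j • (y - x) - y j • (y' - x))) = 0 := by
    funext l
    have h1 := congrFun hx l
    have h2 := congrFun hx' l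
    have h3 := congrFun hy l
    have h4 := congrFun hy' l
    simp only [mulVec_sub, mulVec_smul, Pi.add_apply, Pi.sub_apply, Pi.smul_apply, smul_eq_mul,
      Pi.zero_apply] at *
    linear_combination (y j * y' i * x j + x j * x' i * y' j - x j * x' i * y j) * h1 -
      (y j * y' i * x j) * h2 - (x j * x' i * y' j) * h3 + (x j * x' i * y j) * h4
  have h1 := eq_zero_of_mulVec_eq_zero hA h0
  have hj := congrFun h1 j
  have hk := congrFun h1 k
  simp only [Pi.sub_apply, Pi.smul_apply, smul_eq_mul, Pi.zero_apply] at hj hk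
  refine mul_left_cancel₀ hxj ?_
  linear_combination x j * hk - x k * hj

namespace PLCP

variable {n : ℕ} {I : PLCP n}

/-- The inverse of a singular matrix is zero by convention, which would make entry `i` of the basic
vector vanish. -/
theorem Nondegenerate.det_basisMatrix_ne_zero (hI : I.Nondegenerate) (i : Fin n) (v : Cube n) :
    (I.basisMatrix v).det ≠ 0 := by
  intro h
  refine hI v i ?_
  rw [basicVector, nonsing_inv_apply_not_isUnit _ (by simp [h])]
  simp

theorem Nondegenerate.basisMatrix_mulVec (hI : I.Nondegenerate) (i : Fin n) (v : Cube n) :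
    I.basisMatrix v *ᵥ I.basicVector v = I.q := by
  rw [basicVector, mulVec_mulVec, mul_nonsing_inv, one_mulVec]
  exact (hI.det_basisMatrix_ne_zero i v).isUnit

/-- The change of column `i` of the basis matrix when `v i` is flipped. -/
def colDiff (I : PLCP n) (v : Cube n) (i : Fin n) : Fin n → ℝ :=
  fun l => I.basisMatrix (v + Pi.single i 1) l i - I.basisMatrix v l i

theorem basisMatrix_add_single_mulVec (v : Cube n) (i : Fin n) (x : Fin n → ℝ) :
    I.basisMatrix (v + Pi.single i 1) *ᵥ x = I.basisMatrix v *ᵥ x + x i • I.colDiff v i := by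
  funext l
  have h : ∀ m, I.basisMatrix (v + Pi.single i 1) l m * x m =
      I.basisMatrix v l m * x m + if m = i then x i * I.colDiff v i l else 0 := by
    intro m
    by_cases hm : m = i
    · subst hm
      simp only [colDiff, if_true]
      ring
    · simp [basisMatrix, hm]
  simp only [mulVec, dotProduct, h, Finset.sum_add_distrib, Finset.sum_ite_eq', Finset.mem_univ,
    if_true, Pi.add_apply, Pi.smul_apply, smul_eq_mul]

theorem colDiff_add_single (v : Cube n) {i j : Fin n} (hij : i ≠ j) :
    I.colDiff (v + Pi.single j 1) i = I.colDiff v i := by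
  funext l
  simp [colDiff, basisMatrix, hij]

/-- Sign form of the relation between the solutions on a two-dimensional face. -/
theorem Nondegenerate.plucker (hI : I.Nondegenerate) (v : Cube n) {i j : Fin n} (k : Fin n)
    (hij : i ≠ j) :
    let x := I.basicVector v
    let x' := I.basicVector (v + Pi.single i 1)
    let y := I.basicVector (v + Pi.single j 1)
    let y' := I.basicVector (v + Pi.single j 1 + Pi.single i 1)
    y j * y' i * (x' j * x k - x j * x' k) = x' i * x j * (y' j * y k - y j * y' k) := by
  refine plucker_of_solutions (hI.det_basisMatrix_ne_zero i v) k
    (hI.basisMatrix_mulVec i v) (δi := I.colDiff v i) (δj := I.colDiff v j) ?_ ?_ ?_ (hI v j)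
  · rw [← basisMatrix_add_single_mulVec, hI.basisMatrix_mulVec i]
  · rw [← basisMatrix_add_single_mulVec, hI.basisMatrix_mulVec i]
  · rw [add_right_comm, ← basisMatrix_add_single_mulVec, ← colDiff_add_single v hij,
      ← basisMatrix_add_single_mulVec, hI.basisMatrix_mulVec i]

theorem Nondegenerate.pos_of_outmap (hI : I.Nondegenerate) {v : Cube n} {i : Fin n}
    (h : I.outmap v i = 0) : 0 < I.basicVector v i := by
  refine lt_of_le_of_ne (not_lt.1 fun hlt => ?_) (hI v i).symm
  simp [outmap, hlt] at h

theorem neg_of_outmap {v : Cube n} {i : Fin n} (h : I.outmap v i = 1) :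
    I.basicVector v i < 0 := by
  by_contra hlt
  simp [outmap, hlt] at h

end PLCP

theorem zmod_two_eq (a : ZMod 2) : a = 0 ∨ a = 1 := by
  revert a; decide

/-- The outmaps at `s`, `s + e_i`, `s + e_j` and `s + e_i + e_j` are zero, column `i`, column `j`
and their sum. They fix the signs of the quantities in `plucker`, and the two sides disagree if `M k
j ≠ M i j`. -/
theorem entry_eq_of_realizable {n : ℕ} {M : Matrix (Fin n) (Fin n) (ZMod 2)} {s : Cube n}
    {I : PLCP n} (hI : I.Nondegenerate) (ho : ∀ v, I.outmap v = M *ᵥ (v + s))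
    (hdiag : ∀ i, M i i = 1) {i j k : Fin n} (hki : M k i = 1) (hji : M j i = 0) :
    M k j = M i j := by
  have hij : i ≠ j := by
    rintro rfl
    simp [hdiag] at hji
  have hss : s + s = 0 := funext fun l => CharTwo.add_self_eq_zero (s l)
  have o0 : ∀ l, I.outmap s l = 0 := fun l => by simp [ho, hss]
  have oi : ∀ l, I.outmap (s + Pi.single i 1) l = M l i := fun l => by
    rw [ho, add_right_comm, hss, zero_add]; simp
  have oj : ∀ l, I.outmap (s + Pi.single j 1) l = M l j := fun l => by
    rw [ho, add_right_comm, hss, zero_add]; simp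
  have oji : ∀ l, I.outmap (s + Pi.single j 1 + Pi.single i 1) l = M l j + M l i := fun l => by
    rw [ho, add_right_comm, add_right_comm s, hss, zero_add, mulVec_add]; simp
  have hp := hI.plucker s k hij
  have xj := hI.pos_of_outmap (o0 j)
  have xk := hI.pos_of_outmap (o0 k)
  have x'i := PLCP.neg_of_outmap ((oi i).trans (hdiag i))
  have x'j := hI.pos_of_outmap ((oi j).trans hji)
  have x'k := PLCP.neg_of_outmap ((oi k).trans hki)
  have yj := PLCP.neg_of_outmap ((oj j).trans (hdiag j))
  have y'j := PLCP.neg_of_outmap ((oji j).trans (by rw [hdiag, hji, add_zero]))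
  simp only at hp
  have hL : 0 < I.basicVector (s + Pi.single i 1) j * I.basicVector s k -
      I.basicVector s j * I.basicVector (s + Pi.single i 1) k :=
    sub_pos.2 ((mul_neg_of_pos_of_neg xj x'k).trans (mul_pos x'j xk))
  have hR := mul_neg_of_neg_of_pos x'i xj
  rcases zmod_two_eq (M k j) with hkj | hkj <;> rcases zmod_two_eq (M i j) with hij' | hij'
  · rw [hkj, hij']
  · exfalso
    have y'i := hI.pos_of_outmap ((oji i).trans (by rw [hdiag, hij']; decide))
    have yk := hI.pos_of_outmap ((oj k).trans hkj)
    have y'k := PLCP.neg_of_outmap ((oji k).trans (by rw [hkj, hki]; decide))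
    have h1 := mul_neg_of_neg_of_pos (mul_neg_of_neg_of_pos yj y'i) hL
    have h2 := mul_neg_of_neg_of_pos y'j yk
    have h3 := mul_pos_of_neg_of_neg yj y'k
    have h4 := mul_pos_of_neg_of_neg hR (sub_neg.2 (h2.trans h3))
    rw [hp] at h1
    exact lt_asymm h1 h4
  · exfalso
    have y'i := PLCP.neg_of_outmap ((oji i).trans (by rw [hdiag, hij']; decide))
    have yk := PLCP.neg_of_outmap ((oj k).trans hkj)
    have y'k := hI.pos_of_outmap ((oji k).trans (by rw [hkj, hki]; decide))
    have h1 := mul_pos (mul_pos_of_neg_of_neg yj y'i) hL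
    have h2 := mul_pos_of_neg_of_neg y'j yk
    have h3 := mul_neg_of_neg_of_pos yj y'k
    have h4 := mul_neg_of_neg_of_pos hR (sub_pos.2 (h3.trans h2))
    rw [hp] at h1
    exact lt_asymm h1 h4
  · rw [hkj, hij']

/-- Triangularity gives antisymmetry; transitivity and the chain condition are both instances of
`entry_eq_of_realizable`. -/
theorem isForestOrder_of_realizable {n : ℕ} {M : Matrix (Fin n) (Fin n) (ZMod 2)} {s : Cube n}
    {I : PLCP n} (hI : I.Nondegenerate) (ho : ∀ v, I.outmap v = M *ᵥ (v + s))
    (hdiag : ∀ i, M i i = 1) (σ : Equiv.Perm (Fin n)) (hσ : ∀ i j, σ j < σ i → M i j = 0) :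
    IsForestOrder fun j i => M i j = 1 := by
  have key := @entry_eq_of_realizable n M s I hI ho hdiag
  have hle : ∀ i j, M i j = 1 → σ i ≤ σ j := fun i j h => by
    by_contra hlt
    simp [hσ i j (not_le.1 hlt)] at h
  have anti : ∀ a b, M b a = 1 → M a b = 1 → a = b := fun a b hab hba =>
    σ.injective (le_antisymm (hle _ _ hba) (hle _ _ hab))
  refine ⟨hdiag, anti, fun a b c hab hbc => ?_, fun a b c hac hbc => ?_⟩
  · rcases zmod_two_eq (M a b) with h | h
    · rw [key hbc h, hab]
    · exact anti a b hab h ▸ hbc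
  · rcases zmod_two_eq (M b a) with h | h
    · exact Or.inr (key hac h ▸ hbc)
    · exact Or.inl h

/-! ### Forest orders are realizable -/

/-- The sinks of a face are the solutions of one linear system, whose matrix is triangular with unit
diagonal after reordering. -/
theorem isUSO_of_upperTriangular {n : ℕ} {M : Matrix (Fin n) (Fin n) (ZMod 2)}
    (hdiag : ∀ i, M i i = 1) (σ : Equiv.Perm (Fin n)) (hσ : ∀ i j, σ j < σ i → M i j = 0)
    (s : Cube n) : IsUSO fun v => M *ᵥ (v + s) := by
  refine ⟨fun v i => ?_, fun v S => ?_⟩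
  · simp only
    rw [add_right_comm, mulVec_add _ (v + s), Pi.add_apply, mulVec_single_one, Matrix.col_apply, hdiag]
    simp
  · -- Replace the rows outside of `S` by those of the identity matrix.
    let N : Matrix (Fin n) (Fin n) (ZMod 2) :=
      of fun i j => if i ∈ S then M i j else (1 : Matrix (Fin n) (Fin n) (ZMod 2)) i j
    have hN : IsUnit N.det := by
      rw [det_of_perm_upperTriangular σ σ.injective N fun i j hij => ?_]
      · simp [N, hdiag]
      · have hne : i ≠ j := by rintro rfl; exact lt_irrefl _ hij
        simp [N, hσ i j hij, hne]
    have hrow : ∀ (u : Cube n) i, (N *ᵥ u) i = if i ∈ S then (M *ᵥ u) i else u i := by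
      intro u i
      by_cases hi : i ∈ S
      · simp [N, mulVec, dotProduct, hi]
      · simp [N, mulVec, dotProduct, hi, one_apply]
    let b : Cube n := fun i => if i ∈ S then 0 else v i + s i
    have key : ∀ u : Cube n,
        (u ∈ face v S ∧ ∀ i ∈ S, (M *ᵥ (u + s)) i = 0) ↔ N *ᵥ (u + s) = b := by
      intro u
      rw [funext_iff]
      simp only [hrow, face, Set.mem_ofPred_eq, b]
      constructor
      · rintro ⟨h1, h2⟩ i
        by_cases hi : i ∈ S
        · simp [hi, h2]
        · simp [hi, h1]
      · intro h
        refine ⟨fun i hi => ?_, fun i hi => ?_⟩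
        · simpa [hi] using h i
        · simpa [hi] using h i
    simp only [key]
    refine ⟨N⁻¹ *ᵥ b - s, ?_, fun u hu => ?_⟩
    · simp only [sub_add_cancel, mulVec_mulVec, mul_nonsing_inv N hN, one_mulVec]
    · simp only at hu
      rw [← hu, mulVec_mulVec, nonsing_inv_mul N hN, one_mulVec, add_sub_cancel_right]

/-- The real sign `(-1) ^ a`. -/
noncomputable def zsgn (a : ZMod 2) : ℝ := if a = 0 then 1 else -1

@[simp] theorem zsgn_zero : zsgn 0 = 1 := by simp [zsgn]

@[simp] theorem zsgn_one : zsgn 1 = -1 := by simp [zsgn]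

theorem zsgn_add (a b : ZMod 2) : zsgn (a + b) = zsgn a * zsgn b := by
  have h : (1 + 1 : ZMod 2) = 0 := by decide
  rcases zmod_two_eq a with rfl | rfl <;> rcases zmod_two_eq b with rfl | rfl <;> simp [h]

theorem zsgn_mul_self (a : ZMod 2) : zsgn a * zsgn a = 1 := by
  rcases zmod_two_eq a with rfl | rfl <;> simp

theorem zsgn_ne_zero (a : ZMod 2) : zsgn a ≠ 0 := by
  rcases zmod_two_eq a with rfl | rfl <;> simp

open Classical in
/-- The matrix over `GF(2)` of a relation: column `j` marks the elements above `j`. -/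
noncomputable def forestMatrix {n : ℕ} (r : Fin n → Fin n → Prop) :
    Matrix (Fin n) (Fin n) (ZMod 2) :=
  of fun i j => if r j i then 1 else 0

namespace IsForestOrder

variable {n : ℕ} {r : Fin n → Fin n → Prop}

theorem forestMatrix_diag (hr : IsForestOrder r) (i : Fin n) : forestMatrix r i i = 1 := by
  simp [forestMatrix, hr.refl]

open Classical in
theorem forestMatrix_mulVec (v : Cube n) (i : Fin n) :
    (forestMatrix r *ᵥ v) i = ∑ j, if r j i then v j else 0 := by
  simp [forestMatrix, mulVec, dotProduct]

-- Let `p` be the lower cover of `i`. The left side equals the sign of entry `p` of the product, and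
-- the sum for `i` exceeds the sum for `p` by exactly the term `j = p`. For `s = 0` this is row `i`
-- of the system solved by the basic vector.
open Classical in
theorem zsgn_mul_zsgn_mulVec (hr : IsForestOrder r) (v : Cube n) (i : Fin n) :
    zsgn (v i) * zsgn ((forestMatrix r *ᵥ v) i) =
      1 + ∑ j, if r j i ∧ j ≠ i then
        (1 - zsgn (v j)) * zsgn ((forestMatrix r *ᵥ v) j) else 0 := by
  induction i using hr.wellFounded_strict.induction with
  | _ i ih =>
    rcases hr.minimal_or_exists_pred i with h | ⟨p, hpi, hrp, hp⟩
    · have h1 : ∀ j, r j i ↔ j = i := fun j => ⟨h j, fun h => h ▸ hr.refl _⟩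
      simp [forestMatrix_mulVec, h1, zsgn_mul_self]
    · have hip : ¬ r i p := fun h => hpi (hr.antisymm p i hrp h)
      have h1 : ∀ j, r j i ↔ j = i ∨ r j p := fun j => by
        constructor
        · intro hj
          by_cases hji : j = i
          · exact Or.inl hji
          · exact Or.inr (hp j hji hj)
        · rintro (rfl | hj)
          · exact hr.refl j
          · exact hr.trans j p i hj hrp
      have h2 : (forestMatrix r *ᵥ v) i = v i + (forestMatrix r *ᵥ v) p := by
        have : ∀ j, (if r j i then v j else 0) =
            (if j = i then v j else 0) + if r j p then v j else 0 := fun j => by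
          by_cases hji : j = i
          · subst hji
            simp [hr.refl, hip]
          · simp [h1, hji]
        simp only [forestMatrix_mulVec, this, Finset.sum_add_distrib, Finset.sum_ite_eq',
          Finset.mem_univ, if_true]
      have h3 : ∀ j, (if r j i ∧ j ≠ i then
            (1 - zsgn (v j)) * zsgn ((forestMatrix r *ᵥ v) j) else 0) =
          (if j = p then (1 - zsgn (v j)) * zsgn ((forestMatrix r *ᵥ v) j) else 0) +
          if r j p ∧ j ≠ p then
            (1 - zsgn (v j)) * zsgn ((forestMatrix r *ᵥ v) j) else 0 := fun j => by
        by_cases hjp : j = p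
        · subst hjp
          simp [hrp, hpi]
        · by_cases hji : j = i
          · subst hji
            simp [hjp, hip]
          · simp [h1, hjp, hji]
      have ihp := ih p ⟨hrp, hpi⟩
      simp only [h3, Finset.sum_add_distrib, Finset.sum_ite_eq', Finset.mem_univ, if_true]
      rw [h2, zsgn_add]
      linear_combination ihp + zsgn ((forestMatrix r *ᵥ v) p) * zsgn_mul_self (v i)

end IsForestOrder

open Classical in
/-- A triangular P-matrix which realizes the shifted orientation of a forest order. -/
noncomputable def realForestMatrix {n : ℕ} (r : Fin n → Fin n → Prop) (s : Cube n) :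
    Matrix (Fin n) (Fin n) ℝ :=
  of fun i j => if i = j then 1 else
    if r j i then 2 * zsgn ((forestMatrix r *ᵥ s) i) * zsgn ((forestMatrix r *ᵥ s) j) else 0

section realize

variable {n : ℕ} {r : Fin n → Fin n → Prop} {σ : Equiv.Perm (Fin n)}

theorem forestMatrix_eq_zero (hσ : ∀ i j, r j i → σ i ≤ σ j) {i j : Fin n} (h : σ j < σ i) :
    forestMatrix r i j = 0 := by
  have : ¬ r j i := fun hji => (hσ i j hji).not_gt h
  simp [forestMatrix, this]

theorem realForestMatrix_eq_zero (hσ : ∀ i j, r j i → σ i ≤ σ j) (s : Cube n) {i j : Fin n}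
    (h : σ j < σ i) : realForestMatrix r s i j = 0 := by
  have h1 : ¬ r j i := fun hji => (hσ i j hji).not_gt h
  have h2 : i ≠ j := by rintro rfl; exact lt_irrefl _ h
  simp [realForestMatrix, h1, h2]

theorem IsForestOrder.isPMatrix (hr : IsForestOrder r) (s : Cube n) :
    IsPMatrix (realForestMatrix r s) := by
  obtain ⟨σ, hσ⟩ := hr.exists_perm
  intro S
  rw [det_of_perm_upperTriangular (fun i : {i // i ∈ S} => σ i)
    (σ.injective.comp Subtype.val_injective) (submatrix (realForestMatrix r s) _ _)
    fun i j hij => realForestMatrix_eq_zero hσ s hij]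
  simp [realForestMatrix]

/-- The P-LCP instance realizing the shifted orientation of a forest order. -/
noncomputable def IsForestOrder.plcp (hr : IsForestOrder r) (s : Cube n) : PLCP n where
  M := realForestMatrix r s
  q i := zsgn ((forestMatrix r *ᵥ s) i)
  isPMatrix := hr.isPMatrix s

theorem IsForestOrder.det_plcp_basisMatrix (hr : IsForestOrder r) (s v : Cube n) :
    IsUnit ((hr.plcp s).basisMatrix v).det := by
  obtain ⟨σ, hσ⟩ := hr.exists_perm
  rw [det_of_perm_upperTriangular σ σ.injective _ fun i j hij => ?_]
  · rw [isUnit_iff_ne_zero, Finset.prod_ne_zero_iff]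
    intro i _
    by_cases hv : v i = 1 <;> simp [PLCP.basisMatrix, plcp, realForestMatrix, hv]
  · have h2 : i ≠ j := by rintro rfl; exact lt_irrefl _ hij
    simp [PLCP.basisMatrix, plcp, realForestMatrix_eq_zero hσ s hij, h2]

/-- The sign vector solves the invertible system. The entry 2 of the real matrix is `1 - zsgn 1`,
and a shift by `s` amounts to conjugating by the diagonal matrix of the signs of `forestMatrix r *ᵥ
s`. -/
theorem IsForestOrder.plcp_basicVector (hr : IsForestOrder r) (s v : Cube n) (i : Fin n) :
    (hr.plcp s).basicVector v i = zsgn ((forestMatrix r *ᵥ (v + s)) i) := by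
  classical
  let x : Fin n → ℝ := fun i => zsgn ((forestMatrix r *ᵥ (v + s)) i)
  have hx : (hr.plcp s).basisMatrix v *ᵥ x = (hr.plcp s).q := by
    funext i
    have h1 : ∀ j, (hr.plcp s).basisMatrix v i j * x j =
        (if j = i then zsgn (v i) * x i else 0) -
          zsgn ((forestMatrix r *ᵥ s) i) * if r j i ∧ j ≠ i then
            (1 - zsgn (v j)) * zsgn ((forestMatrix r *ᵥ v) j) else 0 := by
      intro j
      by_cases hji : j = i
      · subst hji
        rcases zmod_two_eq (v j) with hv | hv <;>
          simp [PLCP.basisMatrix, plcp, realForestMatrix, hv]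
      · have hs := zsgn_mul_self ((forestMatrix r *ᵥ s) j)
        have hij : i ≠ j := Ne.symm hji
        by_cases hrji : r j i
        · rcases zmod_two_eq (v j) with hv | hv
          · simp [PLCP.basisMatrix, plcp, hv, hij, hji]
          · simp only [PLCP.basisMatrix, plcp, realForestMatrix, hv, hij, hji, hrji, x,
              mulVec_add, Pi.add_apply, zsgn_add, of_apply, if_true, if_false, zsgn_one, ne_eq,
              not_false_eq_true, and_self]
            linear_combination -2 * zsgn ((forestMatrix r *ᵥ s) i) *
              zsgn ((forestMatrix r *ᵥ v) j) * hs
        · simp [PLCP.basisMatrix, plcp, realForestMatrix, hij, hji, hrji]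
    rw [mulVec, dotProduct]
    simp only [h1, Finset.sum_sub_distrib, Finset.sum_ite_eq', Finset.mem_univ, if_true,
      ← Finset.mul_sum]
    have h2 := hr.zsgn_mul_zsgn_mulVec v i
    simp only [x, plcp, mulVec_add, Pi.add_apply, zsgn_add]
    linear_combination zsgn ((forestMatrix r *ᵥ s) i) * h2
  rw [PLCP.basicVector, ← hx, mulVec_mulVec, nonsing_inv_mul _ (hr.det_plcp_basisMatrix s v),
    one_mulVec]

theorem IsForestOrder.isRealizable (hr : IsForestOrder r) (s : Cube n) :
    IsRealizable fun v => forestMatrix r *ᵥ (v + s) := by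
  obtain ⟨σ, hσ⟩ := hr.exists_perm
  refine ⟨isUSO_of_upperTriangular hr.forestMatrix_diag σ
    (fun i j h => forestMatrix_eq_zero hσ h) s, hr.plcp s, fun v i => ?_, ?_⟩
  · rw [hr.plcp_basicVector]
    exact zsgn_ne_zero _
  · funext v i
    rw [PLCP.outmap, hr.plcp_basicVector]
    rcases zmod_two_eq ((forestMatrix r *ᵥ (v + s)) i) with h | h <;> simp [h]

theorem permMatrix_conj (σ : Equiv.Perm (Fin n)) (A : Matrix (Fin n) (Fin n) (ZMod 2)) :
    σ.permMatrix (ZMod 2) * A * (σ.permMatrix (ZMod 2))ᵀ = A.submatrix σ σ := by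
  rw [Equiv.Perm.permMatrix, ← PEquiv.toMatrix_symm, ← Equiv.toPEquiv_symm,
    PEquiv.toMatrix_toPEquiv_mul, PEquiv.mul_toMatrix_toPEquiv]
  rfl

theorem IsForestOrder.isMatousekType (hr : IsForestOrder r) (s : Cube n) :
    IsMatousekType fun v => forestMatrix r *ᵥ (v + s) := by
  obtain ⟨σ, hσ⟩ := hr.exists_perm
  have hz : ∀ i j : Fin n, j < i → (forestMatrix r).submatrix σ.symm σ.symm i j = 0 :=
    fun i j hij => forestMatrix_eq_zero hσ (by simpa using hij)
  refine ⟨(hr.isRealizable s).1.1, σ, (forestMatrix r).submatrix σ.symm σ.symm, s, ?_, hz, ?_⟩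
  · rw [isUnit_iff_isUnit_det, det_of_perm_upperTriangular id Function.injective_id _ hz]
    simp [hr.forestMatrix_diag]
  · intro v
    rw [permMatrix_conj]
    simp

end realize

/-! ### Counting realizable Matoušek-type orientations -/

/-- Flipping coordinate `i` changes `o v i` by `M i i`, so the orientation condition forces a unit
diagonal. -/
theorem IsMatousekType.exists_matrix {n : ℕ} {o : Cube n → Cube n} (h : IsMatousekType o) :
    ∃ (M : Matrix (Fin n) (Fin n) (ZMod 2)) (s : Cube n) (σ : Equiv.Perm (Fin n)),
      (∀ i, M i i = 1) ∧ (∀ i j, σ j < σ i → M i j = 0) ∧ ∀ v, o v = M *ᵥ (v + s) := by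
  obtain ⟨ho, σ, A, s, -, hA, hv⟩ := h
  simp only [permMatrix_conj] at hv
  refine ⟨A.submatrix σ σ, s, σ, fun i => ?_, fun i j hij => hA _ _ hij, hv⟩
  have h1 := ho 0 i
  rw [hv, hv, add_right_comm, mulVec_add _ (0 + s), Pi.add_apply, mulVec_single_one,
    Matrix.col_apply] at h1
  rcases zmod_two_eq (A.submatrix σ σ i i) with h | h
  · simp at h1
    exact (h1 h).elim
  · exact h

theorem IsForestOrder.forestMatrix_mulVec_injective {n : ℕ} {r : Fin n → Fin n → Prop}
    (hr : IsForestOrder r) : Function.Injective (forestMatrix r).mulVec := by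
  obtain ⟨σ, hσ⟩ := hr.exists_perm
  rw [mulVec_injective_iff_isUnit, isUnit_iff_isUnit_det, det_of_perm_upperTriangular σ σ.injective
    _ fun i j h => forestMatrix_eq_zero hσ h]
  simp [hr.forestMatrix_diag]

theorem forestMatrix_injective {n : ℕ} :
    Function.Injective (forestMatrix : (Fin n → Fin n → Prop) → _) := by
  intro r r' h
  funext j i
  have := congrFun (congrFun h i) j
  by_cases h1 : r j i <;> by_cases h2 : r' j i <;> simp [forestMatrix, h1, h2] at this ⊢

theorem numRealizable_eq (n : ℕ) : numRealizable n = 2 ^ n * (n + 1) ^ (n - 1) := by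
  let F : Cube n × {r : Fin n → Fin n → Prop // IsForestOrder r} →
      {o : Cube n → Cube n // IsMatousekType o ∧ IsRealizable o} :=
    fun x => ⟨fun v => forestMatrix x.2.1 *ᵥ (v + x.1),
      x.2.2.isMatousekType x.1, x.2.2.isRealizable x.1⟩
  have hF : Function.Bijective F := by
    refine ⟨?_, ?_⟩
    · rintro ⟨s, r, hr⟩ ⟨s', r', hr'⟩ h
      have h1 : ∀ v, forestMatrix r *ᵥ (v + s) = forestMatrix r' *ᵥ (v + s') :=
        congrFun (congrArg Subtype.val h)
      -- Column `j` is the difference of the outmaps at `e_j` and `0`.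
      have h2 : forestMatrix r = forestMatrix r' := by
        refine Matrix.ext_of_mulVec_single fun j => ?_
        have h3 := h1 0
        rw [zero_add, zero_add] at h3
        have h4 := h1 (Pi.single j 1)
        rwa [mulVec_add, mulVec_add, h3, add_left_inj] at h4
      obtain rfl := forestMatrix_injective h2
      have h3 := hr.forestMatrix_mulVec_injective (h1 0)
      rw [zero_add, zero_add] at h3
      rw [h3]
    · rintro ⟨o, hM, hR⟩
      obtain ⟨M, s, σ, hdiag, hσ, ho⟩ := hM.exists_matrix
      obtain ⟨-, I, hI, rfl⟩ := hR
      have hr := isForestOrder_of_realizable hI ho hdiag σ hσ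
      refine ⟨⟨s, _, hr⟩, Subtype.ext (funext fun v => ?_)⟩
      have : forestMatrix (fun j i => M i j = 1) = M := by
        ext i j
        rcases zmod_two_eq (M i j) with h | h <;> simp [forestMatrix, h]
      simp only [F, this, ho]
  rw [numRealizable, ← Nat.card_eq_of_bijective F hF, Nat.card_prod, card_isForestOrder]
  simp

/-! ### Asymptotic growth of the count -/

theorem isTheta_logb_numRealizable :
    (fun n : ℕ => Real.logb 2 (numRealizable n)) =Θ[atTop]
      fun n : ℕ => (n : ℝ) * Real.log n := by
  have h2 : 0 < Real.log 2 := Real.log_pos one_lt_two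
  have hlog : ∀ n : ℕ, 1 ≤ n → Real.logb 2 (numRealizable n) =
      (n * Real.log 2 + (n - 1) * Real.log (n + 1)) / Real.log 2 := by
    intro n hn
    rw [numRealizable_eq, Real.logb]
    push_cast
    rw [Real.log_mul (by positivity) (by positivity), Real.log_pow, Real.log_pow,
      Nat.cast_sub hn, Nat.cast_one]
  have hmono : ∀ n : ℕ, 2 ≤ n → Real.log 2 ≤ Real.log n ∧ Real.log n ≤ Real.log (n + 1) ∧
      Real.log (n + 1) ≤ 2 * Real.log n := by
    intro n hn
    have hn' : (2 : ℝ) ≤ n := by exact_mod_cast hn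
    refine ⟨Real.log_le_log two_pos hn', Real.log_le_log (by positivity) (by linarith), ?_⟩
    rw [← Nat.cast_two, ← Real.log_pow]
    exact Real.log_le_log (by positivity) (by nlinarith)
  have hnonneg : ∀ n : ℕ, 2 ≤ n → 0 ≤ Real.logb 2 (numRealizable n) ∧ 0 ≤ n * Real.log n := by
    intro n hn
    obtain ⟨ha, hb, -⟩ := hmono n hn
    have hn' : (2 : ℝ) ≤ n := by exact_mod_cast hn
    have hpos : 0 < Real.log n := h2.trans_le ha
    refine ⟨?_, by positivity⟩
    rw [hlog n (by omega)]
    exact div_nonneg (add_nonneg (by positivity)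
      (mul_nonneg (by linarith) (hpos.le.trans hb))) h2.le
  constructor
  -- With `L = log n`: `n log 2 ≤ n L` and `(n - 1) log (n + 1) ≤ 2 n L`, together `3 n L`.
  · refine IsBigO.of_bound (3 / Real.log 2) (eventually_atTop.2 ⟨2, fun n hn => ?_⟩)
    obtain ⟨ha, hb, hc⟩ := hmono n hn
    have hn' : (2 : ℝ) ≤ n := by exact_mod_cast hn
    have hpos : 0 < Real.log n := h2.trans_le ha
    rw [Real.norm_of_nonneg (hnonneg n hn).1, Real.norm_of_nonneg (hnonneg n hn).2,
      hlog n (by omega), div_mul_eq_mul_div]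
    gcongr
    nlinarith
  -- The constant 2 comes from `n ≤ 2 (n - 1)` for `n ≥ 2`.
  · refine IsBigO.of_bound (2 * Real.log 2) (eventually_atTop.2 ⟨2, fun n hn => ?_⟩)
    obtain ⟨ha, hb, hc⟩ := hmono n hn
    have hn' : (2 : ℝ) ≤ n := by exact_mod_cast hn
    have hpos : 0 < Real.log n := h2.trans_le ha
    rw [Real.norm_of_nonneg (hnonneg n hn).1, Real.norm_of_nonneg (hnonneg n hn).2,
      hlog n (by omega), mul_assoc, mul_div_cancel₀ _ h2.ne']
    nlinarith

end MatousekUSO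

theorem mainTheorem7 :
    (∀ n : ℕ, MatousekUSO.numRealizable n = 2 ^ n * (n + 1) ^ (n - 1)) ∧
      ∃ f : ℕ → ℝ,
        f =Θ[atTop] (fun n : ℕ => (n : ℝ) * Real.log (n : ℝ)) ∧
          ∀ n : ℕ, (MatousekUSO.numRealizable n : ℝ) = (2 : ℝ) ^ f n := by
  -- The exponent `f` is the base-2 logarithm of the count, which is positive.
  refine ⟨MatousekUSO.numRealizable_eq, _, MatousekUSO.isTheta_logb_numRealizable, fun n => ?_⟩
  rw [Real.rpow_logb two_pos one_lt_two.ne']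
  rw [MatousekUSO.numRealizable_eq]
  positivity
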